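/- Formulas are built from a set of propositional variables $p$ by $\varphi ::= p \mid \bot \mid \varphi\land\varphi \mid \varphi\lor\varphi \mid \varphi\to\varphi \mid \Box\varphi \mid \Diamond\varphi$, with $\neg\varphi := \varphi\to\bot$. For a finite multiset $\Gamma$ of formulas, $\Box^{-1}\Gamma$ is the multiset $\{\varphi \mid \Box\varphi\in\Gamma\}$ (with multiplicities), and $\Diamond^{-1}\Gamma$ is defined likewise. **Hilbert calculi.** $\mathsf{CKH}$ derives consecutions $\Gamma\vdash\varphi$, where $\Gamma$ is a set of formulas, by the rules (Ax) $\Gamma\vdash\varphi$ if $\varphi$ is an instance of an axiom; (El) $\Gamma\vdash\varphi$ if $\varphi\in\Gamma$; (MP) from $\Gamma\vdash\varphi$ and $\Gamma\vdash\varphi\to\psi$ infer $\Gamma\vdash\psi$; (Nec) from $\emptyset\vdash\varphi$ infer $\Gamma\vdash\Box\varphi$. The axioms are $\varphi\to(\psi\to\varphi)$; $(\varphi\to(\psi\to\chi))\to((\varphi\to\psi)\to(\varphi\to\chi))$; $\varphi\to(\varphi\lor\psi)$; $\psi\to(\varphi\lor\psi)$; $(\varphi\to\chi)\to((\psi\to\chi)\to((\varphi\lor\psi)\to\chi))$;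 $(\varphi\land\psi)\to\varphi$; $(\varphi\land\psi)\to\psi$; $(\varphi\to\psi)\to((\varphi\to\chi)\to(\varphi\to(\psi\land\chi)))$; $\bot\to\varphi$; $\Box(\varphi\to\psi)\to(\Box\varphi\to\Box\psi)$; $\Box(\varphi\to\psi)\to(\Diamond\varphi\to\Diamond\psi)$. $\mathsf{WKH}$ is $\mathsf{CKH}$ with the additional axiom $\neg\Diamond\bot$. **Sequent calculi.** Sequents are $\Gamma\Rightarrow\Delta$ with $\Gamma,\Delta$ finite multisets of formulas, where $|\Delta|=1$ in $\mathsf{G4CK}$ and $|\Delta|\le 1$ in $\mathsf{G4WK}$. In both calculi the sequents $\Gamma,\bot\Rightarrow\Delta$ and $\Gamma,p\Rightarrow p$ ($p$ a variable) are initial, and the following inferences are rules: - from $\Gamma,\varphi,\psi\Rightarrow\Delta$ infer $\Gamma,\varphi\land\psi\Rightarrow\Delta$; - from $\Gamma\Rightarrow\varphi$ and $\Gamma\Rightarrow\psi$ infer $\Gamma\Rightarrow\varphi\land\psi$; - from $\Gamma,\varphi\Rightarrow\Delta$ and $\Gamma,\psi\Rightarrow\Delta$ infer $\Gamma,\varphi\lor\psi\Rightarrow\Delta$;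 - from $\Gamma\Rightarrow\varphi_i$ infer $\Gamma\Rightarrow\varphi_1\lor\varphi_2$ ($i\in\{1,2\}$); - from $\Gamma,\varphi\Rightarrow\psi$ infer $\Gamma\Rightarrow\varphi\to\psi$; - from $\Gamma,\varphi\to(\psi\to\chi)\Rightarrow\Delta$ infer $\Gamma,(\varphi\land\psi)\to\chi\Rightarrow\Delta$; - from $\Gamma,\varphi\to\chi,\psi\to\chi\Rightarrow\Delta$ infer $\Gamma,(\varphi\lor\psi)\to\chi\Rightarrow\Delta$; - from $\Gamma,p,\varphi\Rightarrow\Delta$ infer $\Gamma,p,p\to\varphi\Rightarrow\Delta$ ($p$ a variable); - from $\Gamma,\psi\to\chi\Rightarrow\varphi\to\psi$ and $\Gamma,\chi\Rightarrow\Delta$ infer $\Gamma,(\varphi\to\psi)\to\chi\Rightarrow\Delta$; - from $\Box^{-1}\Gamma\Rightarrow\varphi$ infer $\Gamma\Rightarrow\Box\varphi$; - from $\Box^{-1}\Gamma\Rightarrow\varphi$ and $\Gamma,\psi\Rightarrow\Delta$ infer $\Gamma,\Box\varphi\to\psi\Rightarrow\Delta$; - from $\Box^{-1}\Gamma,\gamma\Rightarrow\varphi$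 and $\Gamma,\Diamond\gamma,\psi\Rightarrow\Delta$ infer $\Gamma,\Diamond\gamma,\Diamond\varphi\to\psi\Rightarrow\Delta$. $\mathsf{G4CK}$ has in addition the rule: from $\Box^{-1}\Gamma,\varphi\Rightarrow\psi$ infer $\Gamma,\Diamond\varphi\Rightarrow\Diamond\psi$. $\mathsf{G4WK}$ has instead the rule: from $\Box^{-1}\Gamma,\varphi\Rightarrow\Diamond^{-1}\Delta$ infer $\Gamma,\Diamond\varphi\Rightarrow\Delta$. **Theorem.** Let $\Gamma$ be a finite multiset of formulas; on the Hilbert side $\Gamma$ is read as the set of its elements. 1. For every formula $\delta$: $\Gamma\Rightarrow\delta$ is provable in $\mathsf{G4CK}$ if and only if $\Gamma\vdash\delta$ is derivable in $\mathsf{CKH}$. 2. For every multiset $\Delta$ with $|\Delta|\le 1$: $\Gamma\Rightarrow\Delta$ is provable in $\mathsf{G4WK}$ if and only if $\Gamma\vdash\delta$ is derivable in $\mathsf{WKH}$, where $\delta$ is the formula in $\Delta$ if $\Delta$ is a singleton, and $\delta=\bot$ if $\Delta=\emptyset$. -/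

import Mathlib

namespace ConstructiveModal

/-- Formulas of the modal language with independent box and diamond,
over propositional variables from `α`. -/
inductive Formula (α : Type*) where
  | var (p : α) : Formula α
  | bot : Formula α
  | and (φ ψ : Formula α) : Formula α
  | or (φ ψ : Formula α) : Formula α
  | imp (φ ψ : Formula α) : Formula α
  | box (φ : Formula α) : Formula α
  | dia (φ : Formula α) : Formula α

namespace Formula

/-- Negation is an abbreviation. -/
abbrev neg {α : Type*} (φ : Formula α) : Formula α := imp φ bot

/-- `unbox? (□φ) = some φ`, and `none` on all other formulas. -/
def unbox? {α : Type*} : Formula α → Option (Formula α)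
  | box φ => some φ
  | _ => none

/-- `undia? (◇φ) = some φ`, and `none` on all other formulas. -/
def undia? {α : Type*} : Formula α → Option (Formula α)
  | dia φ => some φ
  | _ => none

end Formula

open Formula

/-- The multiset `□⁻¹Γ = {φ | □φ ∈ Γ}`, with multiplicities. -/
def boxInv {α : Type*} (Γ : Multiset (Formula α)) : Multiset (Formula α) :=
  Γ.filterMap unbox?

/-- `◇⁻¹Δ` for a succedent `Δ` with at most one formula:
`◇⁻¹{◇δ} = {δ}`, and it is empty in all other cases. -/
def diaInv {α : Type*} (Δ : Option (Formula α)) : Option (Formula α) :=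
  Δ.bind undia?

/-! ### Generalised Hilbert calculi -/

/-- Instances of the axioms of `CKH`. -/
inductive CKAxiom {α : Type*} : Formula α → Prop
  | a1 (φ ψ : Formula α) : CKAxiom (imp φ (imp ψ φ))
  | a2 (φ ψ χ : Formula α) :
      CKAxiom (imp (imp φ (imp ψ χ)) (imp (imp φ ψ) (imp φ χ)))
  | a3 (φ ψ : Formula α) : CKAxiom (imp φ (or φ ψ))
  | a4 (φ ψ : Formula α) : CKAxiom (imp ψ (or φ ψ))
  | a5 (φ ψ χ : Formula α) :
      CKAxiom (imp (imp φ χ) (imp (imp ψ χ) (imp (or φ ψ) χ)))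
  | a6 (φ ψ : Formula α) : CKAxiom (imp (and φ ψ) φ)
  | a7 (φ ψ : Formula α) : CKAxiom (imp (and φ ψ) ψ)
  | a8 (φ ψ χ : Formula α) :
      CKAxiom (imp (imp φ ψ) (imp (imp φ χ) (imp φ (and ψ χ))))
  | a9 (φ : Formula α) : CKAxiom (imp bot φ)
  | kBox (φ ψ : Formula α) :
      CKAxiom (imp (box (imp φ ψ)) (imp (box φ) (box ψ)))
  | kDia (φ ψ : Formula α) :
      CKAxiom (imp (box (imp φ ψ)) (imp (dia φ) (dia ψ)))

/-- Instances of the axioms of `WKH`: those of `CKH` and the axiom `N`, that is `¬◇⊥`. -/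
inductive WKAxiom {α : Type*} : Formula α → Prop
  | ofCK {φ : Formula α} (h : CKAxiom φ) : WKAxiom φ
  | n : WKAxiom (neg (dia bot))

/-- Provability of consecutions `Γ ⊢ φ`, with `Γ` an arbitrary set of formulas, in the
generalised Hilbert calculus with the axioms `Ax`. -/
inductive Hilbert {α : Type*} (Ax : Formula α → Prop) : Set (Formula α) → Formula α → Prop
  | ax {Γ : Set (Formula α)} {φ : Formula α} (h : Ax φ) : Hilbert Ax Γ φ
  | el {Γ : Set (Formula α)} {φ : Formula α} (h : φ ∈ Γ) : Hilbert Ax Γ φ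
  | nec {Γ : Set (Formula α)} {φ : Formula α} (h : Hilbert Ax ∅ φ) : Hilbert Ax Γ (box φ)
  | mp {Γ : Set (Formula α)} {φ ψ : Formula α} (h₁ : Hilbert Ax Γ φ)
      (h₂ : Hilbert Ax Γ (imp φ ψ)) : Hilbert Ax Γ ψ

/-- `Γ ⊢ φ` in `CKH`. -/
def CKH {α : Type*} (Γ : Set (Formula α)) (φ : Formula α) : Prop := Hilbert CKAxiom Γ φ

/-- `Γ ⊢ φ` in `WKH`. -/
def WKH {α : Type*} (Γ : Set (Formula α)) (φ : Formula α) : Prop := Hilbert WKAxiom Γ φ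

/-! ### Sequent calculi

Antecedents are finite multisets; `φ ::ₘ Γ` is the multiset written `Γ, φ`. -/

/-- Provability in `G4CK` of `Γ ⇒ δ`; succedents have exactly one formula. -/
inductive G4CK {α : Type*} : Multiset (Formula α) → Formula α → Prop
  | botL (Γ : Multiset (Formula α)) (δ : Formula α) : G4CK (bot ::ₘ Γ) δ
  | idP (Γ : Multiset (Formula α)) (p : α) : G4CK (var p ::ₘ Γ) (var p)
  | andL {Γ : Multiset (Formula α)} {φ ψ δ : Formula α}
      (h : G4CK (φ ::ₘ ψ ::ₘ Γ) δ) : G4CK (and φ ψ ::ₘ Γ) δ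
  | andR {Γ : Multiset (Formula α)} {φ ψ : Formula α}
      (h₁ : G4CK Γ φ) (h₂ : G4CK Γ ψ) : G4CK Γ (and φ ψ)
  | orL {Γ : Multiset (Formula α)} {φ ψ δ : Formula α}
      (h₁ : G4CK (φ ::ₘ Γ) δ) (h₂ : G4CK (ψ ::ₘ Γ) δ) : G4CK (or φ ψ ::ₘ Γ) δ
  | orR₁ {Γ : Multiset (Formula α)} {φ ψ : Formula α}
      (h : G4CK Γ φ) : G4CK Γ (or φ ψ)
  | orR₂ {Γ : Multiset (Formula α)} {φ ψ : Formula α}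
      (h : G4CK Γ ψ) : G4CK Γ (or φ ψ)
  | impR {Γ : Multiset (Formula α)} {φ ψ : Formula α}
      (h : G4CK (φ ::ₘ Γ) ψ) : G4CK Γ (imp φ ψ)
  | andImpL {Γ : Multiset (Formula α)} {φ ψ χ δ : Formula α}
      (h : G4CK (imp φ (imp ψ χ) ::ₘ Γ) δ) : G4CK (imp (and φ ψ) χ ::ₘ Γ) δ
  | orImpL {Γ : Multiset (Formula α)} {φ ψ χ δ : Formula α}
      (h : G4CK (imp φ χ ::ₘ imp ψ χ ::ₘ Γ) δ) : G4CK (imp (or φ ψ) χ ::ₘ Γ) δ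
  | varImpL {Γ : Multiset (Formula α)} {p : α} {φ δ : Formula α}
      (h : G4CK (var p ::ₘ φ ::ₘ Γ) δ) : G4CK (var p ::ₘ imp (var p) φ ::ₘ Γ) δ
  | impImpL {Γ : Multiset (Formula α)} {φ ψ χ δ : Formula α}
      (h₁ : G4CK (imp ψ χ ::ₘ Γ) (imp φ ψ)) (h₂ : G4CK (χ ::ₘ Γ) δ) :
      G4CK (imp (imp φ ψ) χ ::ₘ Γ) δ
  | boxR {Γ : Multiset (Formula α)} {φ : Formula α}
      (h : G4CK (boxInv Γ) φ) : G4CK Γ (box φ)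
  | boxImpL {Γ : Multiset (Formula α)} {φ ψ δ : Formula α}
      (h₁ : G4CK (boxInv Γ) φ) (h₂ : G4CK (ψ ::ₘ Γ) δ) : G4CK (imp (box φ) ψ ::ₘ Γ) δ
  | diaImpL {Γ : Multiset (Formula α)} {γ φ ψ δ : Formula α}
      (h₁ : G4CK (γ ::ₘ boxInv Γ) φ) (h₂ : G4CK (dia γ ::ₘ ψ ::ₘ Γ) δ) :
      G4CK (dia γ ::ₘ imp (dia φ) ψ ::ₘ Γ) δ
  | diaL {Γ : Multiset (Formula α)} {φ ψ : Formula α}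
      (h : G4CK (φ ::ₘ boxInv Γ) ψ) : G4CK (dia φ ::ₘ Γ) (dia ψ)

/-- Provability in `G4WK` of `Γ ⇒ Δ`; succedents have at most one formula, `none` standing
for the empty succedent and `some δ` for the singleton `{δ}`. -/
inductive G4WK {α : Type*} : Multiset (Formula α) → Option (Formula α) → Prop
  | botL (Γ : Multiset (Formula α)) (Δ : Option (Formula α)) : G4WK (bot ::ₘ Γ) Δ
  | idP (Γ : Multiset (Formula α)) (p : α) : G4WK (var p ::ₘ Γ) (some (var p))
  | andL {Γ : Multiset (Formula α)} {φ ψ : Formula α} {Δ : Option (Formula α)}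
      (h : G4WK (φ ::ₘ ψ ::ₘ Γ) Δ) : G4WK (and φ ψ ::ₘ Γ) Δ
  | andR {Γ : Multiset (Formula α)} {φ ψ : Formula α}
      (h₁ : G4WK Γ (some φ)) (h₂ : G4WK Γ (some ψ)) : G4WK Γ (some (and φ ψ))
  | orL {Γ : Multiset (Formula α)} {φ ψ : Formula α} {Δ : Option (Formula α)}
      (h₁ : G4WK (φ ::ₘ Γ) Δ) (h₂ : G4WK (ψ ::ₘ Γ) Δ) : G4WK (or φ ψ ::ₘ Γ) Δ
  | orR₁ {Γ : Multiset (Formula α)} {φ ψ : Formula α}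
      (h : G4WK Γ (some φ)) : G4WK Γ (some (or φ ψ))
  | orR₂ {Γ : Multiset (Formula α)} {φ ψ : Formula α}
      (h : G4WK Γ (some ψ)) : G4WK Γ (some (or φ ψ))
  | impR {Γ : Multiset (Formula α)} {φ ψ : Formula α}
      (h : G4WK (φ ::ₘ Γ) (some ψ)) : G4WK Γ (some (imp φ ψ))
  | andImpL {Γ : Multiset (Formula α)} {φ ψ χ : Formula α} {Δ : Option (Formula α)}
      (h : G4WK (imp φ (imp ψ χ) ::ₘ Γ) Δ) : G4WK (imp (and φ ψ) χ ::ₘ Γ) Δ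
  | orImpL {Γ : Multiset (Formula α)} {φ ψ χ : Formula α} {Δ : Option (Formula α)}
      (h : G4WK (imp φ χ ::ₘ imp ψ χ ::ₘ Γ) Δ) : G4WK (imp (or φ ψ) χ ::ₘ Γ) Δ
  | varImpL {Γ : Multiset (Formula α)} {p : α} {φ : Formula α} {Δ : Option (Formula α)}
      (h : G4WK (var p ::ₘ φ ::ₘ Γ) Δ) : G4WK (var p ::ₘ imp (var p) φ ::ₘ Γ) Δ
  | impImpL {Γ : Multiset (Formula α)} {φ ψ χ : Formula α} {Δ : Option (Formula α)}
      (h₁ : G4WK (imp ψ χ ::ₘ Γ) (some (imp φ ψ))) (h₂ : G4WK (χ ::ₘ Γ) Δ) :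
      G4WK (imp (imp φ ψ) χ ::ₘ Γ) Δ
  | boxR {Γ : Multiset (Formula α)} {φ : Formula α}
      (h : G4WK (boxInv Γ) (some φ)) : G4WK Γ (some (box φ))
  | boxImpL {Γ : Multiset (Formula α)} {φ ψ : Formula α} {Δ : Option (Formula α)}
      (h₁ : G4WK (boxInv Γ) (some φ)) (h₂ : G4WK (ψ ::ₘ Γ) Δ) :
      G4WK (imp (box φ) ψ ::ₘ Γ) Δ
  | diaImpL {Γ : Multiset (Formula α)} {γ φ ψ : Formula α} {Δ : Option (Formula α)}
      (h₁ : G4WK (γ ::ₘ boxInv Γ) (some φ)) (h₂ : G4WK (dia γ ::ₘ ψ ::ₘ Γ) Δ) :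
      G4WK (dia γ ::ₘ imp (dia φ) ψ ::ₘ Γ) Δ
  | diaL' {Γ : Multiset (Formula α)} {φ : Formula α} {Δ : Option (Formula α)}
      (h : G4WK (φ ::ₘ boxInv Γ) (diaInv Δ)) : G4WK (dia φ ::ₘ Γ) Δ

/-- The formula denoted by a succedent: `δ` for `{δ}`, and `⊥` for the empty succedent. -/
def succedentFormula {α : Type*} : Option (Formula α) → Formula α
  | some δ => δ
  | none => bot

end ConstructiveModal

/-!
Soundness says that derivability in the Hilbert calculus is closed under the rules of the sequent
calculus. Completeness avoids cut elimination: it is proved by induction on the size of the sequent,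
and which rule to apply backwards to a Hilbert-derivable sequent `Γ ⇒ δ` is read off from an
Aczel slash relation `Γ ∣ φ`. If some `γ ∈ Γ` is not slashed, then `γ` is the principal formula of
a left rule with smaller derivable premises; here a formula `φ → χ` is not slashed only if `Γ ∣ φ`,
which supplies the side premise. If all of `Γ` is slashed, then so is everything derivable from `Γ`,
in particular `δ`, and the slash of `δ` picks a right rule. The slash satisfies the axioms of `CKH`
outright; it can fail `¬◇⊥` only if `□⁻¹Γ, γ ⊢ ⊥` for some `◇γ ∈ Γ`, and then the diamond rule of
`G4WK` applies with an empty succedent.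
-/

namespace ConstructiveModal

open Formula

variable {α : Type*}

/-- `Ax` contains all axioms of `CKH`; the derived rules and the slash are developed for such `Ax`,
so that they serve `CKH` and `WKH` alike. -/
class ContainsCK (Ax : Formula α → Prop) : Prop where
  of_ckAxiom : ∀ {φ : Formula α}, CKAxiom φ → Ax φ

instance : ContainsCK (CKAxiom (α := α)) := ⟨id⟩

instance : ContainsCK (WKAxiom (α := α)) := ⟨.ofCK⟩

/-! ### Derived rules of the Hilbert calculi -/

namespace Hilbert

variable {Ax : Formula α → Prop} {S T : Set (Formula α)} {φ ψ χ δ : Formula α}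

theorem mono (h : Hilbert Ax S φ) (hST : S ⊆ T) : Hilbert Ax T φ := by
  induction h with
  | ax h => exact .ax h
  | el h => exact .el (hST h)
  | nec h _ => exact .nec h
  | mp _ _ ih₁ ih₂ => exact .mp (ih₁ hST) (ih₂ hST)

theorem weaken (h : Hilbert Ax S ψ) : Hilbert Ax (insert φ S) ψ :=
  h.mono (Set.subset_insert _ _)

theorem el_insert : Hilbert Ax (insert φ S) φ := .el (Set.mem_insert _ _)

variable [ContainsCK Ax]

theorem ck (h : CKAxiom φ) : Hilbert Ax S φ := .ax (ContainsCK.of_ckAxiom h)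

theorem ck_mp (h : CKAxiom (imp φ ψ)) (hφ : Hilbert Ax S φ) : Hilbert Ax S ψ := .mp hφ (ck h)

theorem imp_const (h : Hilbert Ax S ψ) : Hilbert Ax S (imp φ ψ) := ck_mp (.a1 ψ φ) h

theorem imp_self : Hilbert Ax S (imp φ φ) :=
  .mp (ck (.a1 φ bot)) (ck_mp (.a2 φ (imp bot φ) φ) (ck (.a1 φ (imp bot φ))))

theorem deduct (h : Hilbert Ax (insert φ S) ψ) : Hilbert Ax S (imp φ ψ) := by
  generalize hT : insert φ S = T at h
  induction h with
  | ax h => exact imp_const (.ax h)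
  | el h =>
    subst hT
    rcases h with rfl | h
    · exact imp_self
    · exact imp_const (.el h)
  | nec h _ => exact imp_const (.nec h)
  | mp _ _ ih₁ ih₂ => exact .mp (ih₁ hT) (ck_mp (.a2 _ _ _) (ih₂ hT))

theorem imp_iff : Hilbert Ax S (imp φ ψ) ↔ Hilbert Ax (insert φ S) ψ :=
  ⟨fun h => .mp el_insert h.weaken, deduct⟩

theorem and_intro (h₁ : Hilbert Ax S φ) (h₂ : Hilbert Ax S ψ) : Hilbert Ax S (and φ ψ) :=
  .mp h₁ <| .mp (imp_const h₂) <| ck_mp (.a8 φ φ ψ) imp_self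

theorem and_left (h : Hilbert Ax S (and φ ψ)) : Hilbert Ax S φ := ck_mp (.a6 φ ψ) h

theorem and_right (h : Hilbert Ax S (and φ ψ)) : Hilbert Ax S ψ := ck_mp (.a7 φ ψ) h

theorem or_inl (h : Hilbert Ax S φ) : Hilbert Ax S (or φ ψ) := ck_mp (.a3 φ ψ) h

theorem or_inr (h : Hilbert Ax S ψ) : Hilbert Ax S (or φ ψ) := ck_mp (.a4 φ ψ) h

theorem or_imp (h₁ : Hilbert Ax S (imp φ χ)) (h₂ : Hilbert Ax S (imp ψ χ)) :
    Hilbert Ax S (imp (or φ ψ) χ) :=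
  .mp h₂ (ck_mp (.a5 φ ψ χ) h₁)

theorem exfalso (h : Hilbert Ax S bot) : Hilbert Ax S φ := ck_mp (.a9 φ) h

theorem box_intro (h : Hilbert Ax (box ⁻¹' S) φ) : Hilbert Ax S (box φ) := by
  generalize hT : box ⁻¹' S = T at h
  induction h with
  | ax h => exact .nec (.ax h)
  | el h => subst hT; exact .el h
  | nec h _ => exact .nec (.nec h)
  | mp _ _ ih₁ ih₂ => exact .mp (ih₁ hT) (ck_mp (.kBox _ _) (ih₂ hT))

theorem insert_dia (h : Hilbert Ax (insert φ (box ⁻¹' S)) ψ) :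
    Hilbert Ax (insert (dia φ) S) (dia ψ) :=
  imp_iff.1 (ck_mp (.kDia φ ψ) h.deduct.box_intro)

theorem insert_congr (h₁ : Hilbert Ax (insert φ S) ψ) (h₂ : Hilbert Ax (insert ψ S) φ) :
    Hilbert Ax (insert φ S) δ ↔ Hilbert Ax (insert ψ S) δ :=
  ⟨fun h => .mp h₂ h.deduct.weaken, fun h => .mp h₁ h.deduct.weaken⟩

theorem insert_and_iff :
    Hilbert Ax (insert (and φ ψ) S) δ ↔ Hilbert Ax (insert φ (insert ψ S)) δ :=
  ⟨fun h => .mp (and_intro el_insert el_insert.weaken) h.deduct.weaken.weaken,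
    fun h => .mp el_insert.and_left (.mp el_insert.and_right h.deduct.deduct.weaken)⟩

theorem insert_or_iff :
    Hilbert Ax (insert (or φ ψ) S) δ ↔
      Hilbert Ax (insert φ S) δ ∧ Hilbert Ax (insert ψ S) δ :=
  ⟨fun h => ⟨.mp el_insert.or_inl h.deduct.weaken, .mp el_insert.or_inr h.deduct.weaken⟩,
    fun ⟨h₁, h₂⟩ => imp_iff.1 (or_imp h₁.deduct h₂.deduct)⟩

theorem insert_imp_iff (hφ : Hilbert Ax (insert (imp φ χ) S) φ) :
    Hilbert Ax (insert (imp φ χ) S) δ ↔ Hilbert Ax (insert χ S) δ :=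
  insert_congr (.mp hφ el_insert) el_insert.imp_const

theorem insert_and_imp_iff :
    Hilbert Ax (insert (imp (and φ ψ) χ) S) δ ↔
      Hilbert Ax (insert (imp φ (imp ψ χ)) S) δ :=
  insert_congr
    (deduct <| deduct <| .mp (and_intro el_insert.weaken el_insert) el_insert.weaken.weaken)
    (deduct <| .mp el_insert.and_right <| .mp el_insert.and_left el_insert.weaken)

theorem insert_or_imp_iff :
    Hilbert Ax (insert (imp (or φ ψ) χ) S) δ ↔
      Hilbert Ax (insert (imp φ χ) (insert (imp ψ χ) S)) δ := by
  constructor <;> intro h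
  · exact .mp (or_imp el_insert el_insert.weaken) h.deduct.weaken.weaken
  · have hφ : Hilbert Ax (insert (imp (or φ ψ) χ) S) (imp φ χ) :=
      deduct (.mp el_insert.or_inl el_insert.weaken)
    have hψ : Hilbert Ax (insert (imp (or φ ψ) χ) S) (imp ψ χ) :=
      deduct (.mp el_insert.or_inr el_insert.weaken)
    exact .mp hφ (.mp hψ h.deduct.deduct.weaken)

theorem insert_imp_imp_iff :
    Hilbert Ax (insert (imp (imp φ ψ) χ) S) (imp φ ψ) ↔
      Hilbert Ax (insert (imp ψ χ) S) (imp φ ψ) := by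
  -- Under `φ`, the formulas `(φ → ψ) → χ` and `ψ → χ` are equivalent.
  rw [imp_iff, imp_iff, Set.insert_comm φ, Set.insert_comm φ]
  exact insert_congr
    (deduct <| .mp el_insert.imp_const el_insert.weaken)
    (deduct <| .mp (.mp el_insert.weaken.weaken el_insert) el_insert.weaken)

end Hilbert

/-! ### The rules of the sequent calculi and soundness -/

theorem setOf_mem_cons (φ : Formula α) (Γ : Multiset (Formula α)) :
    {x | x ∈ φ ::ₘ Γ} = insert φ {x | x ∈ Γ} := by
  ext; simp

theorem boxInv_cons_of_unbox?_eq_none {φ : Formula α} (hφ : φ.unbox? = none)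
    (Γ : Multiset (Formula α)) : boxInv (φ ::ₘ Γ) = boxInv Γ :=
  Multiset.filterMap_cons_none _ _ hφ

theorem boxInv_box_cons (φ : Formula α) (Γ : Multiset (Formula α)) :
    boxInv (box φ ::ₘ Γ) = φ ::ₘ boxInv Γ :=
  Multiset.filterMap_cons_some _ _ _ rfl

theorem unbox?_eq_some_iff {φ ψ : Formula α} : φ.unbox? = some ψ ↔ φ = box ψ := by
  cases φ <;> simp [unbox?]

theorem setOf_mem_boxInv (Γ : Multiset (Formula α)) :
    {x | x ∈ boxInv Γ} = box ⁻¹' {x | x ∈ Γ} := by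
  ext; simp [boxInv, unbox?_eq_some_iff]

/-- Closure of a relation `P` between antecedents and succedent formulas under the rules of `G4CK`
and, if `¬◇⊥` is among the axioms `Ax`, also under the diamond rule of `G4WK` for an empty
succedent. As succedents are single formulas here, `⊥` stands for the empty one, and the rule `diaN`
includes a right weakening to `δ`. -/
structure G4Closed (Ax : Formula α → Prop) (P : Multiset (Formula α) → Formula α → Prop) :
    Prop where
  botL (Γ δ) : P (bot ::ₘ Γ) δ
  idP (Γ p) : P (var p ::ₘ Γ) (var p)
  andL {Γ φ ψ δ} : P (φ ::ₘ ψ ::ₘ Γ) δ → P (and φ ψ ::ₘ Γ) δ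
  andR {Γ φ ψ} : P Γ φ → P Γ ψ → P Γ (and φ ψ)
  orL {Γ φ ψ δ} : P (φ ::ₘ Γ) δ → P (ψ ::ₘ Γ) δ → P (or φ ψ ::ₘ Γ) δ
  orR₁ {Γ φ ψ} : P Γ φ → P Γ (or φ ψ)
  orR₂ {Γ φ ψ} : P Γ ψ → P Γ (or φ ψ)
  impR {Γ φ ψ} : P (φ ::ₘ Γ) ψ → P Γ (imp φ ψ)
  andImpL {Γ φ ψ χ δ} : P (imp φ (imp ψ χ) ::ₘ Γ) δ → P (imp (and φ ψ) χ ::ₘ Γ) δ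
  orImpL {Γ φ ψ χ δ} : P (imp φ χ ::ₘ imp ψ χ ::ₘ Γ) δ → P (imp (or φ ψ) χ ::ₘ Γ) δ
  varImpL {Γ p φ δ} : P (var p ::ₘ φ ::ₘ Γ) δ → P (var p ::ₘ imp (var p) φ ::ₘ Γ) δ
  impImpL {Γ φ ψ χ δ} :
    P (imp ψ χ ::ₘ Γ) (imp φ ψ) → P (χ ::ₘ Γ) δ → P (imp (imp φ ψ) χ ::ₘ Γ) δ
  boxR {Γ φ} : P (boxInv Γ) φ → P Γ (box φ)
  boxImpL {Γ φ ψ δ} : P (boxInv Γ) φ → P (ψ ::ₘ Γ) δ → P (imp (box φ) ψ ::ₘ Γ) δ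
  diaImpL {Γ γ φ ψ δ} : P (γ ::ₘ boxInv Γ) φ → P (dia γ ::ₘ ψ ::ₘ Γ) δ →
    P (dia γ ::ₘ imp (dia φ) ψ ::ₘ Γ) δ
  diaL {Γ φ ψ} : P (φ ::ₘ boxInv Γ) ψ → P (dia φ ::ₘ Γ) (dia ψ)
  diaN {Γ φ δ} : Ax (neg (dia bot)) → P (φ ::ₘ boxInv Γ) bot → P (dia φ ::ₘ Γ) δ

section Soundness

open Hilbert

variable {Ax : Formula α → Prop} {P : Multiset (Formula α) → Formula α → Prop}
  {Γ : Multiset (Formula α)}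

theorem g4Closed_hilbert [ContainsCK Ax] :
    G4Closed Ax fun Γ δ => Hilbert Ax {x | x ∈ Γ} δ := by
  constructor <;> try simp only [setOf_mem_cons, setOf_mem_boxInv]
  case botL => exact fun _ _ => el_insert.exfalso
  case idP => exact fun _ _ => el_insert
  case andL => exact insert_and_iff.2
  case andR => exact and_intro
  case orL => exact fun h₁ h₂ => insert_or_iff.2 ⟨h₁, h₂⟩
  case orR₁ => exact or_inl
  case orR₂ => exact or_inr
  case impR => exact deduct
  case andImpL => exact insert_and_imp_iff.2
  case orImpL => exact insert_or_imp_iff.2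
  case varImpL =>
    intro Γ p φ δ h
    rw [Set.insert_comm] at h ⊢
    exact (insert_imp_iff el_insert.weaken).2 h
  case impImpL => exact fun h₁ h₂ => (insert_imp_iff (insert_imp_imp_iff.2 h₁)).2 h₂
  case boxR => exact box_intro
  case boxImpL => exact fun h₁ h₂ => (insert_imp_iff h₁.box_intro.weaken).2 h₂
  case diaImpL =>
    intro Γ γ φ ψ δ h₁ h₂
    rw [Set.insert_comm] at h₂ ⊢
    exact (insert_imp_iff h₁.insert_dia.weaken).2 h₂
  case diaL => exact insert_dia
  case diaN => exact fun hN h => (Hilbert.mp h.insert_dia (.ax hN)).exfalso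

theorem G4Closed.of_g4CK (hP : G4Closed Ax P) {δ : Formula α} (h : G4CK Γ δ) : P Γ δ := by
  induction h with
  | botL Γ δ => exact hP.botL Γ δ
  | idP Γ p => exact hP.idP Γ p
  | andL _ ih => exact hP.andL ih
  | andR _ _ ih₁ ih₂ => exact hP.andR ih₁ ih₂
  | orL _ _ ih₁ ih₂ => exact hP.orL ih₁ ih₂
  | orR₁ _ ih => exact hP.orR₁ ih
  | orR₂ _ ih => exact hP.orR₂ ih
  | impR _ ih => exact hP.impR ih
  | andImpL _ ih => exact hP.andImpL ih
  | orImpL _ ih => exact hP.orImpL ih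
  | varImpL _ ih => exact hP.varImpL ih
  | impImpL _ _ ih₁ ih₂ => exact hP.impImpL ih₁ ih₂
  | boxR _ ih => exact hP.boxR ih
  | boxImpL _ _ ih₁ ih₂ => exact hP.boxImpL ih₁ ih₂
  | diaImpL _ _ ih₁ ih₂ => exact hP.diaImpL ih₁ ih₂
  | diaL _ ih => exact hP.diaL ih

theorem diaInv_eq_none_or_eq_some_dia (Δ : Option (Formula α)) :
    diaInv Δ = none ∨ ∃ ψ, Δ = some (dia ψ) := by
  rcases Δ with _ | δ
  · exact .inl rfl
  · cases δ <;> simp [diaInv, undia?]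

theorem G4Closed.of_g4WK (hP : G4Closed Ax P) (hN : Ax (neg (dia bot)))
    {Δ : Option (Formula α)} (h : G4WK Γ Δ) : P Γ (succedentFormula Δ) := by
  induction h with
  | botL Γ Δ => exact hP.botL Γ (succedentFormula Δ)
  | idP Γ p => exact hP.idP Γ p
  | andL _ ih => exact hP.andL ih
  | andR _ _ ih₁ ih₂ => exact hP.andR ih₁ ih₂
  | orL _ _ ih₁ ih₂ => exact hP.orL ih₁ ih₂
  | orR₁ _ ih => exact hP.orR₁ ih
  | orR₂ _ ih => exact hP.orR₂ ih
  | impR _ ih => exact hP.impR ih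
  | andImpL _ ih => exact hP.andImpL ih
  | orImpL _ ih => exact hP.orImpL ih
  | varImpL _ ih => exact hP.varImpL ih
  | impImpL _ _ ih₁ ih₂ => exact hP.impImpL ih₁ ih₂
  | boxR _ ih => exact hP.boxR ih
  | boxImpL _ _ ih₁ ih₂ => exact hP.boxImpL ih₁ ih₂
  | diaImpL _ _ ih₁ ih₂ => exact hP.diaImpL ih₁ ih₂
  | @diaL' _ _ Δ _ ih =>
    rcases diaInv_eq_none_or_eq_some_dia Δ with hΔ | ⟨ψ, rfl⟩
    · rw [hΔ] at ih
      exact hP.diaN hN ih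
    · exact hP.diaL ih

end Soundness

theorem G4WK.exfalso {Γ : Multiset (Formula α)} {Δ : Option (Formula α)} (h : G4WK Γ Δ)
    (hΔ : succedentFormula Δ = bot) (Δ' : Option (Formula α)) : G4WK Γ Δ' := by
  induction h generalizing Δ' with
  | botL Γ _ => exact .botL Γ Δ'
  | idP | andR | orR₁ | orR₂ | impR | boxR => cases hΔ
  | andL _ ih => exact .andL (ih hΔ Δ')
  | orL _ _ ih₁ ih₂ => exact .orL (ih₁ hΔ Δ') (ih₂ hΔ Δ')
  | andImpL _ ih => exact .andImpL (ih hΔ Δ')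
  | orImpL _ ih => exact .orImpL (ih hΔ Δ')
  | varImpL _ ih => exact .varImpL (ih hΔ Δ')
  | impImpL h₁ _ _ ih₂ => exact .impImpL h₁ (ih₂ hΔ Δ')
  | boxImpL h₁ _ _ ih₂ => exact .boxImpL h₁ (ih₂ hΔ Δ')
  | diaImpL h₁ _ _ ih₂ => exact .diaImpL h₁ (ih₂ hΔ Δ')
  | @diaL' _ _ Δ _ ih =>
    rcases diaInv_eq_none_or_eq_some_dia Δ with hnone | ⟨ψ, rfl⟩
    · exact .diaL' (ih (by rw [hnone]; rfl) (diaInv Δ'))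
    · cases hΔ

theorem g4WK_some_succedentFormula_iff {Γ : Multiset (Formula α)} {Δ : Option (Formula α)} :
    G4WK Γ (some (succedentFormula Δ)) ↔ G4WK Γ Δ := by
  cases Δ with
  | none => exact ⟨fun h => h.exfalso rfl none, fun h => h.exfalso rfl (some bot)⟩
  | some δ => rfl

theorem g4Closed_g4CK : G4Closed CKAxiom (G4CK (α := α)) :=
  ⟨.botL, .idP, .andL, .andR, .orL, .orR₁, .orR₂, .impR, .andImpL, .orImpL, .varImpL, .impImpL,
    .boxR, .boxImpL, .diaImpL, .diaL, nofun⟩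

theorem g4Closed_g4WK :
    G4Closed WKAxiom fun (Γ : Multiset (Formula α)) δ => G4WK Γ (some δ) :=
  ⟨fun Γ δ => .botL Γ (some δ), .idP, .andL, .andR, .orL, .orR₁, .orR₂, .impR, .andImpL, .orImpL,
    .varImpL, .impImpL, .boxR, .boxImpL, .diaImpL, fun h => .diaL' h,
    fun {_ _ δ} _ h => .diaL' (h.exfalso rfl (diaInv (some δ)))⟩

/-! ### The termination measure -/

namespace Formula

/-- The size of a formula: a polynomial interpretation of the connectives, with values at least `2`,
under which the premises of every rule of the sequent calculi have smaller total size than its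
conclusion. Taking a sum for `∨` and a product for `→` accommodates the rule for `(φ ∨ ψ) → χ`,
which copies `χ`. -/
def size : Formula α → ℕ
  | var _ => 2
  | bot => 2
  | and φ ψ => (φ.size + 1) * (ψ.size + 1)
  | or φ ψ => φ.size + ψ.size + 1
  | imp φ ψ => φ.size * ψ.size + 1
  | box φ => φ.size + 1
  | dia φ => φ.size + 3

variable (φ ψ χ : Formula α)

theorem two_le_size : 2 ≤ φ.size := by
  induction φ with
  | var | bot => rfl
  | _ => simp only [size]; nlinarith

theorem size_add_size_lt_and : φ.size + ψ.size < (and φ ψ).size := by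
  simp only [size]
  nlinarith

theorem size_add_size_lt_or : φ.size + ψ.size < (or φ ψ).size := Nat.lt_succ_self _

theorem size_add_size_lt_imp : φ.size + ψ.size < (imp φ ψ).size :=
  Nat.lt_succ_of_le (Nat.add_le_mul φ.two_le_size ψ.two_le_size)

theorem size_lt_box : φ.size < (box φ).size := Nat.lt_succ_self _

theorem size_add_size_bot_lt_dia : φ.size + (bot : Formula α).size < (dia φ).size :=
  Nat.lt_succ_self _

theorem size_imp_imp_lt_and_imp : (imp φ (imp ψ χ)).size < (imp (and φ ψ) χ).size := by
  have := χ.two_le_size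
  simp only [size]
  nlinarith

theorem size_imp_add_size_imp_lt_or_imp :
    (imp φ χ).size + (imp ψ χ).size < (imp (or φ ψ) χ).size := by
  have := χ.two_le_size
  simp only [size]
  nlinarith

theorem size_imp_add_size_imp_lt_imp_imp :
    (imp ψ χ).size + (imp φ ψ).size < (imp (imp φ ψ) χ).size := by
  have hχ := χ.two_le_size
  have : φ.size + χ.size ≤ φ.size * χ.size := Nat.add_le_mul φ.two_le_size hχ
  simp only [size]
  nlinarith

end Formula

/-- The total size of the formulas of an antecedent. -/
def totalSize (Γ : Multiset (Formula α)) : ℕ := (Γ.map Formula.size).sum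

theorem totalSize_cons (φ : Formula α) (Γ : Multiset (Formula α)) :
    totalSize (φ ::ₘ Γ) = φ.size + totalSize Γ := by
  simp [totalSize]

theorem totalSize_boxInv_le (Γ : Multiset (Formula α)) :
    totalSize (boxInv Γ) ≤ totalSize Γ := by
  induction Γ using Multiset.induction with
  | empty => rfl
  | cons φ Γ ih =>
    cases φ with
    | box φ =>
      rw [boxInv_box_cons, totalSize_cons, totalSize_cons]
      exact Nat.add_le_add φ.size_lt_box.le ih
    | _ =>
      rw [boxInv_cons_of_unbox?_eq_none rfl, totalSize_cons]
      exact ih.trans (Nat.le_add_left _ _)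

/-! ### The slash relation -/

/-- The Aczel slash `S ∣ φ` for derivability from the axioms `Ax`, with clauses for the modalities
that mirror the premises of the modal right rules. It is used to read off from a derivable sequent
the rule that concludes it. -/
def Slash (Ax : Formula α → Prop) (S : Set (Formula α)) : Formula α → Prop
  | .var p => var p ∈ S
  | .bot => False
  | .and φ ψ => Slash Ax S φ ∧ Slash Ax S ψ
  | .or φ ψ => Slash Ax S φ ∨ Slash Ax S ψ
  | .imp φ ψ => Hilbert Ax S (imp φ ψ) ∧ (Slash Ax S φ → Slash Ax S ψ)
  | .box φ => Hilbert Ax (box ⁻¹' S) φ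
  | .dia φ => ∃ γ, dia γ ∈ S ∧ Hilbert Ax (insert γ (box ⁻¹' S)) φ

section Slash

open Hilbert

variable {Ax : Formula α → Prop} {S : Set (Formula α)} {φ : Formula α}

theorem Hilbert.slash (hAx : ∀ φ, Ax φ → Slash Ax S φ) (hS : ∀ γ ∈ S, Slash Ax S γ)
    (h : Hilbert Ax S φ) : Slash Ax S φ := by
  induction h with
  | ax h => exact hAx _ h
  | el h => exact hS _ h
  | nec h _ => exact h.mono (Set.empty_subset _)
  | mp _ _ ih₁ ih₂ => exact (ih₂ hAx hS).2 (ih₁ hAx hS)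

variable [ContainsCK Ax]

theorem Slash.hilbert : ∀ {φ : Formula α}, Slash Ax S φ → Hilbert Ax S φ
  | .var _, hp => .el hp
  | .bot, h => h.elim
  | .and _ _, ⟨hφ, hψ⟩ => and_intro hφ.hilbert hψ.hilbert
  | .or _ _, .inl hφ => or_inl hφ.hilbert
  | .or _ _, .inr hψ => or_inr hψ.hilbert
  | .imp _ _, h => h.1
  | .box _, h => box_intro h
  | .dia _, ⟨_, hγ, h⟩ => h.insert_dia.mono (Set.insert_subset hγ subset_rfl)

theorem CKAxiom.slash (h : CKAxiom φ) : Slash Ax S φ := by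
  induction h with
  | a1 φ ψ => exact ⟨ck (.a1 φ ψ), fun hφ => ⟨hφ.hilbert.imp_const, fun _ => hφ⟩⟩
  | a2 φ ψ χ =>
    exact ⟨ck (.a2 φ ψ χ), fun hφψχ => ⟨ck_mp (.a2 φ ψ χ) hφψχ.1, fun hφψ =>
      ⟨.mp hφψ.1 (ck_mp (.a2 φ ψ χ) hφψχ.1), fun hφ => (hφψχ.2 hφ).2 (hφψ.2 hφ)⟩⟩⟩
  | a3 φ ψ => exact ⟨ck (.a3 φ ψ), .inl⟩
  | a4 φ ψ => exact ⟨ck (.a4 φ ψ), .inr⟩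
  | a5 φ ψ χ =>
    exact ⟨ck (.a5 φ ψ χ), fun hφχ => ⟨ck_mp (.a5 φ ψ χ) hφχ.1, fun hψχ =>
      ⟨or_imp hφχ.1 hψχ.1, fun h => h.elim hφχ.2 hψχ.2⟩⟩⟩
  | a6 φ ψ => exact ⟨ck (.a6 φ ψ), And.left⟩
  | a7 φ ψ => exact ⟨ck (.a7 φ ψ), And.right⟩
  | a8 φ ψ χ =>
    exact ⟨ck (.a8 φ ψ χ), fun hφψ => ⟨ck_mp (.a8 φ ψ χ) hφψ.1, fun hφχ =>
      ⟨.mp hφχ.1 (ck_mp (.a8 φ ψ χ) hφψ.1), fun hφ => ⟨hφψ.2 hφ, hφχ.2 hφ⟩⟩⟩⟩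
  | a9 φ => exact ⟨ck (.a9 φ), False.elim⟩
  | kBox φ ψ =>
    exact ⟨ck (.kBox φ ψ), fun hφψ =>
      ⟨ck_mp (.kBox φ ψ) (box_intro hφψ), fun hφ => .mp hφ hφψ⟩⟩
  | kDia φ ψ =>
    exact ⟨ck (.kDia φ ψ), fun hφψ =>
      ⟨ck_mp (.kDia φ ψ) (box_intro hφψ), fun ⟨γ, hγ, hφ⟩ => ⟨γ, hγ, .mp hφ (weaken hφψ)⟩⟩⟩

theorem WKAxiom.slash (h : WKAxiom φ) (hφ : Ax φ)
    (hN : Ax (neg (dia bot)) → ¬ Slash Ax S (dia bot)) : Slash Ax S φ := by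
  cases h with
  | ofCK h => exact h.slash
  | n => exact ⟨.ax hφ, hN hφ⟩

end Slash

/-! ### Completeness -/

/-- `P` contains all derivable sequents of total size less than `n`; this is the induction
hypothesis of the completeness proof. -/
def CompleteBelow (Ax : Formula α → Prop) (P : Multiset (Formula α) → Formula α → Prop) (n : ℕ) :
    Prop :=
  ∀ ⦃Γ : Multiset (Formula α)⦄ ⦃δ : Formula α⦄,
    totalSize Γ + δ.size < n → Hilbert Ax {x | x ∈ Γ} δ → P Γ δ

namespace G4Closed

open Hilbert

variable {Ax : Formula α → Prop} {P : Multiset (Formula α) → Formula α → Prop}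
  {Γ : Multiset (Formula α)} {γ δ φ χ : Formula α}

theorem of_slash_dia_bot (hP : G4Closed Ax P) (hN : Ax (neg (dia bot)))
    (ih : CompleteBelow Ax P (totalSize Γ + δ.size)) (h : Slash Ax {x | x ∈ Γ} (dia bot)) :
    P Γ δ := by
  obtain ⟨γ, hγ, hbot⟩ := h
  obtain ⟨Γ, rfl⟩ := Multiset.exists_cons_of_mem hγ
  rw [← setOf_mem_boxInv, boxInv_cons_of_unbox?_eq_none rfl, ← setOf_mem_cons] at hbot
  have := totalSize_boxInv_le Γ
  have := size_add_size_bot_lt_dia γ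
  exact hP.diaN hN (ih (by simp only [totalSize_cons]; omega) hbot)

theorem dia_imp_cons_of_slash (hP : G4Closed Ax P)
    (ih : CompleteBelow Ax P (totalSize (imp (dia φ) χ ::ₘ Γ) + δ.size))
    (hφ : Slash Ax {x | x ∈ imp (dia φ) χ ::ₘ Γ} (dia φ)) (hχ : P (χ ::ₘ Γ) δ) :
    P (imp (dia φ) χ ::ₘ Γ) δ := by
  obtain ⟨γ, hγ, hφ⟩ := hφ
  obtain ⟨Γ, rfl⟩ : ∃ Γ', Γ = dia γ ::ₘ Γ' :=
    Multiset.exists_cons_of_mem ((Multiset.mem_cons.1 hγ).resolve_left nofun)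
  rw [← setOf_mem_boxInv, ← setOf_mem_cons] at hφ
  rw [boxInv_cons_of_unbox?_eq_none rfl, boxInv_cons_of_unbox?_eq_none rfl] at hφ
  rw [Multiset.cons_swap] at hχ ⊢
  have := totalSize_boxInv_le Γ
  have := size_add_size_lt_imp (dia φ) χ
  have := size_add_size_bot_lt_dia φ
  have := size_add_size_bot_lt_dia γ
  exact hP.diaImpL (ih (by simp only [totalSize_cons]; omega) hφ) hχ

variable [ContainsCK Ax]

theorem of_slash (hP : G4Closed Ax P) (ih : CompleteBelow Ax P (totalSize Γ + δ.size))
    (hδ : Slash Ax {x | x ∈ Γ} δ) : P Γ δ := by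
  cases δ with
  | var p =>
    obtain ⟨Γ, rfl⟩ := Multiset.exists_cons_of_mem hδ
    exact hP.idP Γ p
  | bot => exact hδ.elim
  | and φ ψ =>
    have := size_add_size_lt_and φ ψ
    exact hP.andR (ih (by omega) hδ.1.hilbert) (ih (by omega) hδ.2.hilbert)
  | or φ ψ =>
    have := size_add_size_lt_or φ ψ
    rcases hδ with hφ | hψ
    · exact hP.orR₁ (ih (by omega) hφ.hilbert)
    · exact hP.orR₂ (ih (by omega) hψ.hilbert)
  | imp φ ψ =>
    have := size_add_size_lt_imp φ ψ
    refine hP.impR (ih (by rw [totalSize_cons]; omega) ?_)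
    rw [setOf_mem_cons]
    exact imp_iff.1 hδ.1
  | box φ =>
    have := totalSize_boxInv_le Γ
    have := size_lt_box φ
    refine hP.boxR (ih (by omega) ?_)
    rw [setOf_mem_boxInv]
    exact hδ
  | dia φ =>
    obtain ⟨γ, hγ, hφ⟩ := hδ
    obtain ⟨Γ, rfl⟩ := Multiset.exists_cons_of_mem hγ
    rw [← setOf_mem_boxInv, boxInv_cons_of_unbox?_eq_none rfl, ← setOf_mem_cons] at hφ
    have := totalSize_boxInv_le Γ
    have := size_add_size_bot_lt_dia φ
    have := size_add_size_bot_lt_dia γ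
    exact hP.diaL (ih (by simp only [totalSize_cons]; omega) hφ)

theorem imp_cons_of_slash (hP : G4Closed Ax P)
    (ih : CompleteBelow Ax P (totalSize (imp φ χ ::ₘ Γ) + δ.size))
    (h : Hilbert Ax {x | x ∈ imp φ χ ::ₘ Γ} δ) (hφ : Slash Ax {x | x ∈ imp φ χ ::ₘ Γ} φ) :
    P (imp φ χ ::ₘ Γ) δ := by
  have hφ' := hφ.hilbert
  have hlt := size_add_size_lt_imp φ χ
  rw [setOf_mem_cons] at h hφ'
  have hχ : P (χ ::ₘ Γ) δ := ih (by simp only [totalSize_cons]; omega) <| by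
    rw [setOf_mem_cons]
    exact (insert_imp_iff hφ').1 h
  cases φ with
  | var p =>
    obtain ⟨Γ, rfl⟩ : ∃ Γ', Γ = var p ::ₘ Γ' :=
      Multiset.exists_cons_of_mem ((Multiset.mem_cons.1 hφ).resolve_left nofun)
    rw [Multiset.cons_swap] at hχ ⊢
    exact hP.varImpL hχ
  | bot => exact hφ.elim
  | and φ ψ =>
    have := size_imp_imp_lt_and_imp φ ψ χ
    refine hP.andImpL (ih (by simp only [totalSize_cons]; omega) ?_)
    rw [setOf_mem_cons]
    exact insert_and_imp_iff.1 h
  | or φ ψ =>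
    have := size_imp_add_size_imp_lt_or_imp φ ψ χ
    refine hP.orImpL (ih (by simp only [totalSize_cons]; omega) ?_)
    simp only [setOf_mem_cons]
    exact insert_or_imp_iff.1 h
  | imp φ ψ =>
    have := size_imp_add_size_imp_lt_imp_imp φ ψ χ
    have := δ.two_le_size
    refine hP.impImpL (ih (by simp only [totalSize_cons]; omega) ?_) hχ
    rw [setOf_mem_cons]
    exact insert_imp_imp_iff.1 hφ'
  | box φ =>
    rw [Slash, ← setOf_mem_boxInv, boxInv_cons_of_unbox?_eq_none rfl] at hφ
    have := totalSize_boxInv_le Γ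
    have := size_lt_box φ
    exact hP.boxImpL (ih (by rw [totalSize_cons]; omega) hφ) hχ
  | dia φ => exact hP.dia_imp_cons_of_slash ih hφ hχ

theorem cons_of_not_slash (hP : G4Closed Ax P)
    (ih : CompleteBelow Ax P (totalSize (γ ::ₘ Γ) + δ.size))
    (h : Hilbert Ax {x | x ∈ γ ::ₘ Γ} δ) (hγ : ¬ Slash Ax {x | x ∈ γ ::ₘ Γ} γ) :
    P (γ ::ₘ Γ) δ := by
  cases γ with
  | var p => exact absurd (Multiset.mem_cons_self _ _) hγ
  | bot => exact hP.botL Γ δ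
  | and φ ψ =>
    have := size_add_size_lt_and φ ψ
    refine hP.andL (ih (by simp only [totalSize_cons]; omega) ?_)
    simp only [setOf_mem_cons] at h ⊢
    exact insert_and_iff.1 h
  | or φ ψ =>
    have := size_add_size_lt_or φ ψ
    rw [setOf_mem_cons, insert_or_iff, ← setOf_mem_cons, ← setOf_mem_cons] at h
    exact hP.orL (ih (by simp only [totalSize_cons]; omega) h.1)
      (ih (by simp only [totalSize_cons]; omega) h.2)
  | imp φ χ =>
    have hφ : Slash Ax {x | x ∈ imp φ χ ::ₘ Γ} φ := by
      by_contra hφ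
      exact hγ ⟨.el (Multiset.mem_cons_self _ _), fun h => absurd h hφ⟩
    exact hP.imp_cons_of_slash ih h hφ
  | box φ => exact absurd (.el (Multiset.mem_cons_self _ _)) hγ
  | dia φ => exact absurd ⟨φ, Multiset.mem_cons_self _ _, el_insert⟩ hγ

theorem of_hilbert (hP : G4Closed Ax P) (hAx : ∀ φ, Ax φ → WKAxiom φ)
    (h : Hilbert Ax {x | x ∈ Γ} δ) : P Γ δ := by
  induction hn : totalSize Γ + δ.size using Nat.strong_induction_on generalizing Γ δ with
  | _ n ih =>
  subst hn
  replace ih : CompleteBelow Ax P (totalSize Γ + δ.size) := fun _ _ hlt h => ih _ hlt h rfl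
  by_cases hΓ : ∀ γ ∈ Γ, Slash Ax {x | x ∈ Γ} γ
  · by_cases hN : Ax (neg (dia bot)) ∧ Slash Ax {x | x ∈ Γ} (dia bot)
    · exact hP.of_slash_dia_bot hN.1 ih hN.2
    · have hslash : ∀ φ, Ax φ → Slash Ax {x | x ∈ Γ} φ :=
        fun φ hφ => (hAx φ hφ).slash hφ (not_and.1 hN)
      exact hP.of_slash ih (h.slash hslash hΓ)
  · push Not at hΓ
    obtain ⟨γ, hγ, hslash⟩ := hΓ
    obtain ⟨Γ, rfl⟩ := Multiset.exists_cons_of_mem hγ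
    exact hP.cons_of_not_slash ih h hslash

end G4Closed

end ConstructiveModal

theorem theorem2 {α : Type*} :
    (∀ (Γ : Multiset (ConstructiveModal.Formula α)) (δ : ConstructiveModal.Formula α),
      ConstructiveModal.G4CK Γ δ ↔ ConstructiveModal.CKH {φ | φ ∈ Γ} δ) ∧
    (∀ (Γ : Multiset (ConstructiveModal.Formula α)) (Δ : Option (ConstructiveModal.Formula α)),
      ConstructiveModal.G4WK Γ Δ ↔
        ConstructiveModal.WKH {φ | φ ∈ Γ} (ConstructiveModal.succedentFormula Δ)) := by
  refine ⟨fun Γ δ => ⟨fun h => ?_, fun h => ?_⟩, fun Γ Δ => ⟨fun h => ?_, fun h => ?_⟩⟩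
  · exact ConstructiveModal.g4Closed_hilbert.of_g4CK h
  · exact ConstructiveModal.g4Closed_g4CK.of_hilbert (fun _ => .ofCK) h
  · exact ConstructiveModal.g4Closed_hilbert.of_g4WK .n h
  · rw [← ConstructiveModal.g4WK_some_succedentFormula_iff]
    exact ConstructiveModal.g4Closed_g4WK.of_hilbert (fun _ => id) h
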